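/- Let $n\ge 0$, let $\Omega_n=\{-1,1\}^n$ carry the uniform probability with expectation $\mathbb E$, and let $e_j\in\Omega_n$ be the point whose $j$-th coordinate is $-1$ and whose other coordinates are $1$. For $f:\Omega_n\to\mathbb C$ put $\partial_jf(x)=f(x)-f(xe_j)$ (coordinatewise product), $|\nabla f|(x)=\big(\sum_{j=1}^n|\partial_jf(x)|^2\big)^{1/2}$, $\|g\|_\infty=\max_{\Omega_n}|g|$, and $\Delta=\sum_{j=1}^n\partial_j^2$. The Walsh functions $\omega_A(x)=\prod_{j\in A}x_j$, $A\subseteq\{1,\dots,n\}$, satisfy $\Delta\omega_A=4|A|\,\omega_A$, and for $\alpha>0$ one sets $\Delta^\alpha f=\sum_{A}(4|A|)^\alpha\,\mathbb E[f\omega_A]\,\omega_A$. Then for every $f:\Omega_n\to\mathbb C$: 1. $$\mathbb E\,e^{|f-\mathbb Ef|}\le 2\,\mathbb E\,e^{\frac{\pi^2}{32}|\nabla f|^2}\le 2\,e^{\frac{\pi^2}{32}\|\,|\nabla f|\,\|_\infty^2}.$$ 2. For every $0<\alpha<\frac12$, the function $\theta\mapsto(-\log\cos\theta)^{-\alpha}$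 is integrable on $[0,\frac\pi2]$ and, with $K_\alpha=\frac1{\Gamma(1-\alpha)}\int_0^{\pi/2}(-\log\cos\theta)^{-\alpha}\,d\theta$, $$\mathbb E\,e^{|\Delta^\alpha f|}\le 2\,\mathbb E\,e^{\frac12K_\alpha^2|\nabla f|^2}\le 2\,e^{\frac12K_\alpha^2\|\,|\nabla f|\,\|_\infty^2}.$$ -/

import Mathlib

open scoped BigOperators

/-- The discrete cube `{-1,1}^n`, a group under coordinatewise multiplication. -/
abbrev Cube (n : ℕ) : Type := Fin n → ℤˣ

namespace Cube

/-- The point `e_j = (1, …, -1, …, 1)`, with `-1` at coordinate `j`. -/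
def flip {n : ℕ} (j : Fin n) : Cube n := Pi.mulSingle j (-1)

/-- The discrete partial derivative `(∂_j f)(x) = f x - f (x e_j)`. -/
def partialDeriv {n : ℕ} (j : Fin n) (f : Cube n → ℂ) : Cube n → ℂ :=
  fun x => f x - f (x * flip j)

/-- The length of the discrete gradient, `|∇f|(x) = (∑_j |∂_j f(x)|²)^{1/2}`. -/
noncomputable def gradLength {n : ℕ} (f : Cube n → ℂ) (x : Cube n) : ℝ :=
  Real.sqrt (∑ j : Fin n, ‖partialDeriv j f x‖ ^ 2)

/-- The discrete Laplacian `Δ = ∑_j ∂_j²`. -/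
def laplacian {n : ℕ} (f : Cube n → ℂ) : Cube n → ℂ :=
  fun x => ∑ j : Fin n, partialDeriv j (partialDeriv j f) x

/-- The Walsh function `ω_A = ∏_{j ∈ A} ω_j`, where `ω_j` is the `j`-th coordinate function. -/
def walsh {n : ℕ} (A : Finset (Fin n)) (x : Cube n) : ℂ :=
  ∏ j ∈ A, ((x j : ℤ) : ℂ)

/-- The Walsh coefficient `𝔼[f ω_A]` (the Walsh functions are real-valued). -/
noncomputable def walshCoeff {n : ℕ} (f : Cube n → ℂ) (A : Finset (Fin n)) : ℂ :=
  𝔼 x : Cube n, f x * walsh A x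

/-- The power `Δ^α`, for `α > 0`, given by the spectral decomposition of `Δ`: the Walsh functions
are a basis (`walsh_expansion`) of eigenvectors of `Δ`, the eigenvalue of `ω_A` being `4|A|`
(`laplacian_walsh`), and `Δ^α` multiplies `ω_A` by `(4|A|)^α`. -/
noncomputable def laplacianPow {n : ℕ} (α : ℝ) (f : Cube n → ℂ) : Cube n → ℂ :=
  fun x => ∑ A : Finset (Fin n), (((4 * (A.card : ℝ)) ^ α : ℝ) : ℂ) * walshCoeff f A * walsh A x

/-- The constant `K_α = Γ(1-α)⁻¹ ‖(-log cos θ)^{-α}‖_{L¹([0,π/2])}`. -/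
noncomputable def constK (α : ℝ) : ℝ :=
  (1 / Real.Gamma (1 - α)) *
    ∫ θ in Set.Icc 0 (Real.pi / 2), |(-Real.log (Real.cos θ)) ^ (-α)|

theorem partialDeriv_walsh {n : ℕ} (j : Fin n) (A : Finset (Fin n)) (c : ℂ) :
    partialDeriv j (fun x => c * walsh A x) =
      fun x => (if j ∈ A then 2 * c else 0) * walsh A x := by
  funext x
  have key : walsh A (x * flip j) = (if j ∈ A then -1 else 1) * walsh A x := by
    unfold walsh flip
    have h : ∀ i ∈ A, (((((x * Pi.mulSingle j (-1) : Cube n) i : ℤˣ) : ℤ) : ℂ)) =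
        (if i = j then (-1 : ℂ) else 1) * (((x i : ℤˣ) : ℤ) : ℂ) := by
      intro i _
      by_cases hi : i = j
      · subst hi; simp
      · simp [hi]
    rw [Finset.prod_congr rfl h, Finset.prod_mul_distrib, Finset.prod_ite_eq']
  simp only [partialDeriv, key]
  split_ifs <;> ring

/-- The Walsh function `ω_A` is an eigenvector of `Δ` for the eigenvalue `4|A|`. -/
theorem laplacian_walsh {n : ℕ} (A : Finset (Fin n)) :
    laplacian (walsh A) = fun x => (4 * (A.card : ℂ)) * walsh A x := by
  funext x
  have h (j : Fin n) : partialDeriv j (partialDeriv j (walsh A)) x =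
      (if j ∈ A then 4 else 0) * walsh A x := by
    have h1 : walsh A = fun x => 1 * walsh A x := by simp
    rw [h1, partialDeriv_walsh, partialDeriv_walsh]
    split_ifs <;> norm_num
  simp only [laplacian, h, ← Finset.sum_mul]
  simp [mul_comm]

/-- The Walsh expansion of a function on the cube. -/
theorem walsh_expansion {n : ℕ} (f : Cube n → ℂ) (x : Cube n) :
    f x = ∑ A : Finset (Fin n), walshCoeff f A * walsh A x := by
  have key (y : Cube n) : ∑ A : Finset (Fin n), walsh A y * walsh A x =
      if y = x then (2 : ℂ) ^ n else 0 := by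
    have h1 : ∑ A : Finset (Fin n), walsh A y * walsh A x =
        ∏ j : Fin n, (1 + ((y j : ℤ) : ℂ) * ((x j : ℤ) : ℂ)) := by
      rw [Finset.prod_one_add, Finset.powerset_univ]
      exact Finset.sum_congr rfl fun A _ => by simp [walsh, Finset.prod_mul_distrib]
    rw [h1]
    split_ifs with hyx
    · subst hyx
      have : ∀ j : Fin n, (1 + ((y j : ℤ) : ℂ) * ((y j : ℤ) : ℂ)) = 2 := by
        intro j
        rcases Int.units_eq_one_or (y j) with h | h <;> simp [h] <;> norm_num
      simp [this]
    · obtain ⟨j, hj⟩ := Function.ne_iff.mp hyx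
      refine Finset.prod_eq_zero (Finset.mem_univ j) ?_
      rcases Int.units_eq_one_or (y j) with h | h <;>
        rcases Int.units_eq_one_or (x j) with h' | h' <;> simp_all
  have hc : (Fintype.card (Cube n) : ℂ) = 2 ^ n := by simp [Cube]
  simp only [walshCoeff, Fintype.expect_eq_sum_div_card, hc, Finset.sum_div, Finset.sum_mul]
  rw [Finset.sum_comm]
  have h2 (y : Cube n) : ∑ A : Finset (Fin n), f y * walsh A y / 2 ^ n * walsh A x =
      f y / 2 ^ n * (if y = x then (2 : ℂ) ^ n else 0) := by
    rw [← key, Finset.mul_sum]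
    exact Finset.sum_congr rfl fun A _ => by ring
  simp [h2]

end Cube

/-! Let `R` be the `n`-fold tensor power of the plane rotation of angle `θ/2`. Its squared entries
form the kernel of the noise operator that multiplies `ω_A` by `(cos θ)^|A|`, so this operator
applied to `f` is the diagonal of `Rᵀ M R`, with `M` the multiplication by `f`. Differentiating in
`θ` turns `M` into a sum over `j` of flips of coordinate `j` weighted by `±∂_j f / 2`
(`hasDerivAt_noise`).

After doubling the space to make that sum Hermitian, Peierls' inequality bounds the sum of
exponentials of its diagonal entries in any orthonormal basis by one trace, so `θ` disappears. The
flips are then removed from the trace one at a time: conjugation by the `j`-th coordinate function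
changes the sign of the `j`-th flip alone, the square of a flip is diagonal, and
`trace_exp_add_add_trace_exp_sub_le` replaces `±T` by `T²/2`. This yields `sum_exp_noiseDeriv_le`,
uniformly in `θ`.

Finally `f - 𝔼 f` and `Δ^α f` are integrals over `[0, π/2]` of the noise derivative against explicit
weights, and Jensen's inequality (`expect_exp_norm_le`) gives the constant `W²/8`, where `W` is the
total mass of the weight. -/

namespace Matrix

/-! ### Hermitian matrices and their spectral form -/

theorem IsHermitian.real_smul {ι : Type*} {A : Matrix ι ι ℂ} (hA : A.IsHermitian) (r : ℝ) :
    (r • A).IsHermitian := by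
  unfold IsHermitian
  rw [conjTranspose_smul, hA]; simp

theorem IsHermitian.mul_self {ι : Type*} [Fintype ι] {A : Matrix ι ι ℂ} (hA : A.IsHermitian) :
    (A * A).IsHermitian := by
  unfold IsHermitian
  rw [conjTranspose_mul, hA]

/-- The path from `H + T²/2` to `H + T`. -/
noncomputable def interpolation {ι : Type*} [Fintype ι] (H T : Matrix ι ι ℂ) (u : ℝ) :
    Matrix ι ι ℂ :=
  H + u • T + ((1 - u ^ 2) / 2) • (T * T)

theorem isHermitian_interpolation {ι : Type*} [Fintype ι] {H T : Matrix ι ι ℂ} (hH : H.IsHermitian)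
    (hT : T.IsHermitian) (u : ℝ) : (interpolation H T u).IsHermitian :=
  (hH.add (hT.real_smul u)).add (hT.mul_self.real_smul _)

theorem continuous_interpolation {ι : Type*} [Fintype ι] (H T : Matrix ι ι ℂ) :
    Continuous (interpolation H T) := by
  unfold interpolation
  fun_prop

/-- The matrix of a weighted involution `σ`. -/
def weightedInvolution {ι : Type*} [DecidableEq ι] (σ : ι → ι) (t : ι → ℂ) : Matrix ι ι ℂ :=
  of fun i k => if k = σ i then t i else 0

theorem isHermitian_weightedInvolution {ι : Type*} [DecidableEq ι] {σ : ι → ι}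
    (hσ : ∀ i, σ (σ i) = i) {t : ι → ℂ} (ht : ∀ i, t (σ i) = star (t i)) : (weightedInvolution σ t).IsHermitian := by
  ext i k
  simp only [weightedInvolution, conjTranspose_apply, of_apply]
  by_cases h : k = σ i
  · subst h; simp [hσ, ht]
  · have h' : i ≠ σ k := by rintro rfl; exact h (hσ k).symm
    simp [h, h']

variable {ι : Type*} [Fintype ι] [DecidableEq ι]

/-- The matrix with eigenvalues `a` on the orthonormal basis given by the columns of `U`. -/
noncomputable def spectralConj (U : Matrix ι ι ℂ) (a : ι → ℝ) : Matrix ι ι ℂ :=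
  U * diagonal (fun i => (a i : ℂ)) * Uᴴ


theorem spectralConj_mul {U : Matrix ι ι ℂ} (hU : Uᴴ * U = 1) (a b : ι → ℝ) :
    spectralConj U a * spectralConj U b = spectralConj U (fun i => a i * b i) := by
  have h : diagonal (fun i => (a i : ℂ)) * diagonal (fun i => (b i : ℂ)) =
      diagonal (fun i => ((a i * b i : ℝ) : ℂ)) := by
    rw [diagonal_mul_diagonal]; simp
  unfold spectralConj
  rw [← h]
  calc U * diagonal (fun i => (a i : ℂ)) * Uᴴ * (U * diagonal (fun i => (b i : ℂ)) * Uᴴ)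
      = U * diagonal (fun i => (a i : ℂ)) * (Uᴴ * U) * diagonal (fun i => (b i : ℂ)) * Uᴴ := by
        simp only [mul_assoc]
    _ = _ := by rw [hU]; simp only [mul_assoc, one_mul]

theorem spectralConj_one {U : Matrix ι ι ℂ} (hU : Uᴴ * U = 1) :
    spectralConj U (fun _ => 1) = 1 := by
  simp [spectralConj, mul_eq_one_comm.mp hU]

theorem exp_spectralConj {U : Matrix ι ι ℂ} (hU : Uᴴ * U = 1) (a : ι → ℝ) :
    NormedSpace.exp (spectralConj U a) = spectralConj U (fun i => Real.exp (a i)) := by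
  have h : U⁻¹ = Uᴴ := inv_eq_left_inv hU
  have hu : IsUnit U := IsUnit.of_mul_eq_one _ (mul_eq_one_comm.mp hU)
  unfold spectralConj
  rw [← h, exp_conj _ _ hu, exp_diagonal]
  congr 3
  funext i
  rw [Pi.coe_exp]; simp [Complex.exp_eq_exp_ℂ]

theorem IsHermitian.exists_spectralConj {A : Matrix ι ι ℂ} (hA : A.IsHermitian) :
    ∃ (U : Matrix ι ι ℂ) (a : ι → ℝ), Uᴴ * U = 1 ∧ A = spectralConj U a := by
  refine ⟨hA.eigenvectorUnitary, hA.eigenvalues, ?_, ?_⟩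
  · rw [← star_eq_conjTranspose]; simp
  · conv_lhs => rw [hA.spectral_theorem, Unitary.conjStarAlgAut_apply]
    rfl

/-- The weights `|⟨u_i, v_j⟩|²` are nonnegative, so a trace inequality between functions of two
noncommuting Hermitian matrices reduces to a scalar inequality at each pair of eigenvalues. -/
theorem trace_spectralConj_mul_spectralConj (U V : Matrix ι ι ℂ) (a b : ι → ℝ) :
    (spectralConj U a * spectralConj V b).trace =
      ((∑ i, ∑ j, Complex.normSq ((Uᴴ * V) i j) * (a i * b j) : ℝ) : ℂ) := by
  have h : (spectralConj U a * spectralConj V b).trace =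
      (diagonal (fun i => (a i : ℂ)) * (Uᴴ * V) *
        (diagonal (fun i => (b i : ℂ)) * (Uᴴ * V)ᴴ)).trace := by
    unfold spectralConj
    rw [conjTranspose_mul, conjTranspose_conjTranspose, mul_assoc U, mul_assoc U, trace_mul_comm U]
    simp only [mul_assoc]
  rw [h]
  simp only [trace, diag_apply, mul_apply (M := diagonal (fun i => (a i : ℂ)) * (Uᴴ * V)),
    diagonal_mul, conjTranspose_apply]
  push_cast
  refine Finset.sum_congr rfl fun i _ => Finset.sum_congr rfl fun j _ => ?_
  rw [Complex.normSq_eq_conj_mul_self]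
  simp only [RCLike.star_def]
  ring

/-! ### Trace inequalities for the exponential -/

/-- This is the trapezoidal bound for the convex function `exp`, equivalent to `tanh (t/2) ≤ t/2`
for `t ≥ 0`. -/
theorem sub_mul_exp_sub_exp_le (a b : ℝ) :
    (b - a) * (Real.exp b - Real.exp a) ≤ 1 / 2 * ((b - a) ^ 2 * (Real.exp b + Real.exp a)) := by
  have key : ∀ t : ℝ, 0 ≤ t → Real.exp t - 1 ≤ t / 2 * (Real.exp t + 1) := by
    have hd : ∀ t : ℝ, HasDerivAt (fun t : ℝ => t / 2 * (Real.exp t + 1) - (Real.exp t - 1))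
        (1 / 2 * (Real.exp t + 1) + t / 2 * Real.exp t - Real.exp t) t := fun t =>
      (((hasDerivAt_id t).div_const 2).mul ((Real.hasDerivAt_exp t).add_const 1)).sub
        ((Real.hasDerivAt_exp t).sub_const 1)
    have hm : Monotone (fun t : ℝ => t / 2 * (Real.exp t + 1) - (Real.exp t - 1)) := by
      refine monotone_of_hasDerivAt_nonneg hd fun t => ?_
      have h1 := Real.add_one_le_exp (-t)
      have h2 : Real.exp (-t) * Real.exp t = 1 := by rw [← Real.exp_add]; simp
      have := mul_le_mul_of_nonneg_right h1 (Real.exp_pos t).le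
      simp only [Pi.zero_apply]
      nlinarith
    intro t ht
    have := hm ht
    simp at this
    linarith
  have main : ∀ a b : ℝ, a ≤ b →
      (b - a) * (Real.exp b - Real.exp a) ≤ 1 / 2 * ((b - a) ^ 2 * (Real.exp b + Real.exp a)) := by
    intro a b hab
    have h1 := key (b - a) (sub_nonneg.mpr hab)
    have h2 : Real.exp b = Real.exp (b - a) * Real.exp a := by rw [← Real.exp_add]; simp
    have h3 := mul_le_mul_of_nonneg_left h1
      (mul_nonneg (sub_nonneg.mpr hab) (Real.exp_pos a).le)
    rw [h2]
    linarith
  rcases le_total a b with h | h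
  · exact main a b h
  · linarith [main b a h]

/-- A trace mean value inequality for the exponential. -/
theorem trace_sub_mul_exp_sub_exp_le {A B : Matrix ι ι ℂ} (hA : A.IsHermitian)
    (hB : B.IsHermitian) :
    ((B - A) * (NormedSpace.exp B - NormedSpace.exp A)).trace.re ≤
      1 / 2 * ((B - A) * (B - A) * (NormedSpace.exp B + NormedSpace.exp A)).trace.re := by
  obtain ⟨U, a, hU, rfl⟩ := hA.exists_spectralConj
  obtain ⟨V, b, hV, rfl⟩ := hB.exists_spectralConj
  rw [exp_spectralConj hU, exp_spectralConj hV]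
  set S := spectralConj U
  set R := spectralConj V
  have hS : ∀ p q, S p * S q = S (fun i => p i * q i) := spectralConj_mul hU
  have hR : ∀ p q, R p * R q = R (fun i => p i * q i) := spectralConj_mul hV
  have hS1 : S (fun _ => 1) = 1 := spectralConj_one hU
  have hR1 : R (fun _ => 1) = 1 := spectralConj_one hV
  have hSR : ∀ p q, (S p * R q).trace =
    ((∑ i, ∑ j, Complex.normSq ((Uᴴ * V) i j) * (p i * q j) : ℝ) : ℂ) :=
    trace_spectralConj_mul_spectralConj U V
  have hSs : ∀ p, (S p).trace =
      ((∑ i, ∑ j, Complex.normSq ((Uᴴ * V) i j) * p i : ℝ) : ℂ) := by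
    intro p
    have := hSR p (fun _ => 1)
    rw [hR1, mul_one] at this
    simpa using this
  have hRs : ∀ p, (R p).trace =
      ((∑ i, ∑ j, Complex.normSq ((Uᴴ * V) i j) * p j : ℝ) : ℂ) := by
    intro p
    have := hSR (fun _ => 1) p
    rw [hS1, one_mul] at this
    simpa using this
  set ea := fun i => Real.exp (a i)
  set eb := fun i => Real.exp (b i)
  have e1 : ((R b - S a) * (R eb - S ea)).trace =
      (R b * R eb).trace - (S ea * R b).trace - (S a * R eb).trace + (S a * S ea).trace := by
    rw [trace_mul_comm (S ea), ← trace_sub, ← trace_sub, ← trace_add]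
    congr 1; noncomm_ring
  -- Cyclicity of the trace brings each word into the form (function of `A`) times (function of
  -- `B`), to which the double spectral sum applies.
  have e2 : ((R b - S a) * (R b - S a) * (R eb + S ea)).trace =
      (R b * R b * R eb).trace + (S ea * (R b * R b)).trace
      - (S a * (R eb * R b)).trace - ((S ea * S a) * R b).trace
      - (S a * (R b * R eb)).trace - ((S a * S ea) * R b).trace
      + (S a * S a * R eb).trace + (S a * S a * S ea).trace := by
    have c1 : (S ea * (R b * R b)).trace = ((R b * R b) * S ea).trace := trace_mul_comm _ _
    have c2 : (S a * (R eb * R b)).trace = (R b * S a * R eb).trace := by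
      rw [← mul_assoc, trace_mul_comm, ← mul_assoc]
    have c3 : ((S ea * S a) * R b).trace = (S a * R b * S ea).trace := by
      rw [mul_assoc, trace_mul_comm]
    have c4 : ((S a * S ea) * R b).trace = (R b * S a * S ea).trace := by
      rw [trace_mul_comm, mul_assoc]
    rw [c1, c2, c3, c4]
    simp only [← trace_sub, ← trace_add]
    congr 1; noncomm_ring
  rw [e1, e2]
  simp only [hS, hR, hSR, hSs, hRs]
  simp only [← Complex.ofReal_add, ← Complex.ofReal_sub, Complex.ofReal_re]
  simp only [← Finset.sum_sub_distrib, ← Finset.sum_add_distrib, Finset.mul_sum]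
  refine Finset.sum_le_sum fun i _ => Finset.sum_le_sum fun j _ => ?_
  have := mul_le_mul_of_nonneg_left (sub_mul_exp_sub_exp_le (a i) (b j))
    (Complex.normSq_nonneg ((Uᴴ * V) i j))
  simp only [ea, eb]
  nlinarith [this]

/-- Klein's inequality: the convexity of `A ↦ tr exp A`. -/
theorem trace_exp_add_trace_sub_mul_exp_le {A B : Matrix ι ι ℂ} (hA : A.IsHermitian)
    (hB : B.IsHermitian) :
    (NormedSpace.exp A).trace.re + ((B - A) * NormedSpace.exp A).trace.re ≤
      (NormedSpace.exp B).trace.re := by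
  obtain ⟨U, a, hU, rfl⟩ := hA.exists_spectralConj
  obtain ⟨V, b, hV, rfl⟩ := hB.exists_spectralConj
  rw [exp_spectralConj hU, exp_spectralConj hV]
  set S := spectralConj U
  set R := spectralConj V
  have hS : ∀ p q, S p * S q = S (fun i => p i * q i) := spectralConj_mul hU
  have hS1 : S (fun _ => 1) = 1 := spectralConj_one hU
  have hR1 : R (fun _ => 1) = 1 := spectralConj_one hV
  have hSR : ∀ p q, (S p * R q).trace =
    ((∑ i, ∑ j, Complex.normSq ((Uᴴ * V) i j) * (p i * q j) : ℝ) : ℂ) :=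
    trace_spectralConj_mul_spectralConj U V
  have hSs : ∀ p, (S p).trace =
      ((∑ i, ∑ j, Complex.normSq ((Uᴴ * V) i j) * p i : ℝ) : ℂ) := by
    intro p
    have := hSR p (fun _ => 1)
    rw [hR1, mul_one] at this
    simpa using this
  have hRs : ∀ p, (R p).trace =
      ((∑ i, ∑ j, Complex.normSq ((Uᴴ * V) i j) * p j : ℝ) : ℂ) := by
    intro p
    have := hSR (fun _ => 1) p
    rw [hS1, one_mul] at this
    simpa using this
  rw [sub_mul, trace_sub, trace_mul_comm (R b)]
  simp only [hS, hSR, hSs, hRs]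
  simp only [← Complex.ofReal_sub, Complex.ofReal_re]
  simp only [← Finset.sum_sub_distrib, ← Finset.sum_add_distrib]
  refine Finset.sum_le_sum fun i _ => Finset.sum_le_sum fun j _ => ?_
  have h1 := Real.add_one_le_exp (b j - a i)
  have h2 : Real.exp (b j) = Real.exp (b j - a i) * Real.exp (a i) := by
    rw [← Real.exp_add]; simp
  have h3 : Real.exp (a i) + (b j - a i) * Real.exp (a i) ≤ Real.exp (b j) := by
    rw [h2]; nlinarith [Real.exp_pos (a i)]
  nlinarith [mul_le_mul_of_nonneg_left h3 (Complex.normSq_nonneg ((Uᴴ * V) i j))]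

/-- Peierls' inequality. -/
theorem sum_exp_le_trace_exp {A V : Matrix ι ι ℂ} (hA : A.IsHermitian) (hV : Vᴴ * V = 1)
    (d : ι → ℝ) (hd : ∀ k, (Vᴴ * A * V) k k = d k) :
    ∑ k, Real.exp (d k) ≤ (NormedSpace.exp A).trace.re := by
  have hH : (spectralConj V d).IsHermitian := by
    unfold spectralConj IsHermitian
    simp only [conjTranspose_mul, conjTranspose_conjTranspose, diagonal_conjTranspose, mul_assoc]
    congr 3
    funext i; simp
  -- Klein's inequality is applied at the diagonal part of `A` in the basis `V`; the first-order
  -- term vanishes because the two matrices have the same diagonal there.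
  have h := trace_exp_add_trace_sub_mul_exp_le hH hA
  have htr : ∀ (B : Matrix ι ι ℂ) (p : ι → ℝ), (B * spectralConj V p).trace =
      ∑ k, (Vᴴ * B * V) k k * p k := by
    intro B p
    unfold spectralConj
    rw [← mul_assoc, trace_mul_comm, ← mul_assoc, ← mul_assoc]
    simp [trace, mul_diagonal]
  have e1 : ∀ p : ι → ℝ, (spectralConj V p).trace = ((∑ k, p k : ℝ) : ℂ) := by
    intro p
    have := htr 1 p
    rw [one_mul] at this
    rw [this]
    simp [hV]
  rw [exp_spectralConj hV, sub_mul, trace_sub, htr A, spectralConj_mul hV, e1, e1] at h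
  simp only [hd, ← Complex.ofReal_mul, ← Complex.ofReal_sum, ← Complex.ofReal_sub,
    Complex.ofReal_re] at h
  linarith

theorem continuous_exp_complex :
    Continuous (NormedSpace.exp : Matrix ι ι ℂ → Matrix ι ι ℂ) := by
  open scoped Norms.Operator in exact NormedSpace.exp_continuous

/-- Klein's inequality at `±v` gives the increment `(v - u) P - (v² - u²)/2 * Q`, and the mean value
inequality, applied to the two endpoints differing by `2vT`, gives `P ≤ v Q`. The coefficient `1 -
u²` in the path makes what remains exactly `(v - u)²/2 * Q`, of second order. -/
theorem interpolation_step {H T : Matrix ι ι ℂ} (hH : H.IsHermitian)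
    (hT : T.IsHermitian) {u v : ℝ} (hu : 0 ≤ u) (huv : u < v) :
    (NormedSpace.exp (interpolation H T v)).trace.re +
      (NormedSpace.exp (interpolation H T (-v))).trace.re ≤
    (NormedSpace.exp (interpolation H T u)).trace.re +
      (NormedSpace.exp (interpolation H T (-u))).trace.re +
      (v - u) ^ 2 / 2 * ((T * T) * (NormedSpace.exp (interpolation H T v) +
        NormedSpace.exp (interpolation H T (-v)))).trace.re := by
  have hK := isHermitian_interpolation hH hT
  have k1 := trace_exp_add_trace_sub_mul_exp_le (hK v) (hK u)
  have k2 := trace_exp_add_trace_sub_mul_exp_le (hK (-v)) (hK (-u))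
  have k3 := trace_sub_mul_exp_sub_exp_le (hK (-v)) (hK v)
  have d1 : interpolation H T u - interpolation H T v =
      (u - v) • T + ((v ^ 2 - u ^ 2) / 2) • (T * T) := by
    unfold interpolation; module
  have d2 : interpolation H T (-u) - interpolation H T (-v) =
      (v - u) • T + ((v ^ 2 - u ^ 2) / 2) • (T * T) := by
    unfold interpolation; module
  have d3 : interpolation H T v - interpolation H T (-v) = (2 * v) • T := by
    unfold interpolation; module
  rw [d1] at k1
  rw [d2] at k2
  rw [d3] at k3
  simp only [add_mul, mul_add, mul_sub, smul_mul_assoc, mul_smul_comm, trace_add, trace_sub,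
    trace_smul, Complex.add_re, Complex.sub_re, Complex.smul_re, smul_eq_mul] at k1 k2 k3 ⊢
  set P := (T * NormedSpace.exp (interpolation H T v)).trace.re -
    (T * NormedSpace.exp (interpolation H T (-v))).trace.re with hP
  set Q := (T * T * NormedSpace.exp (interpolation H T v)).trace.re +
    (T * T * NormedSpace.exp (interpolation H T (-v))).trace.re with hQ
  have hv : 0 < v := hu.trans_lt huv
  have h4 : P ≤ v * Q := by
    have : v * P ≤ v * (v * Q) := by rw [hP, hQ]; nlinarith [k3]
    exact le_of_mul_le_mul_left this hv
  have h5 := mul_le_mul_of_nonneg_left h4 (sub_nonneg.mpr huv.le)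
  rw [hP] at h5
  nlinarith [k1, k2, h5]

/-- The noncommutative analogue of `cosh t ≤ exp (t² / 2)`, in the presence of a further
Hermitian summand. -/
theorem trace_exp_add_add_trace_exp_sub_le {H T : Matrix ι ι ℂ} (hH : H.IsHermitian)
    (hT : T.IsHermitian) :
    (NormedSpace.exp (H + T)).trace.re + (NormedSpace.exp (H - T)).trace.re ≤
      2 * (NormedSpace.exp (H + (1 / 2 : ℝ) • (T * T))).trace.re := by
  set φ : ℝ → ℝ := fun u => (NormedSpace.exp (interpolation H T u)).trace.re +
      (NormedSpace.exp (interpolation H T (-u))).trace.re with hφ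
  have hc : Continuous fun v : ℝ => ((T * T) * (NormedSpace.exp (interpolation H T v) +
        NormedSpace.exp (interpolation H T (-v)))).trace.re := by
    have h1 := continuous_exp_complex.comp (continuous_interpolation H T)
    have h2 := h1.comp continuous_neg
    have h3 : Continuous fun v : ℝ => NormedSpace.exp (interpolation H T v) +
        NormedSpace.exp (interpolation H T (-v)) := h1.add h2
    exact Complex.continuous_re.comp (continuous_const.matrix_mul h3).matrix_trace
  obtain ⟨C, hC⟩ := (isCompact_Icc (a := (0 : ℝ)) (b := 1)).bddAbove_image hc.continuousOn
  have hstep : ∀ u v : ℝ, 0 ≤ u → u < v → v ≤ 1 → φ v ≤ φ u + (v - u) ^ 2 / 2 * C := by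
    intro u v hu huv hv
    refine (interpolation_step hH hT hu huv).trans ?_
    have := hC ⟨v, ⟨hu.trans huv.le, hv⟩, rfl⟩
    simp only [hφ]
    have := mul_le_mul_of_nonneg_left this (by positivity : 0 ≤ (v - u) ^ 2 / 2)
    linarith
  -- With `N + 1` equal steps the quadratic errors add up to `O(1/N)`, which shows `φ 1 ≤ φ 0`
  -- without differentiating the matrix exponential.
  have hN : ∀ N : ℕ, φ 1 ≤ φ 0 + C / 2 * (1 / ((N : ℝ) + 1)) := by
    intro N
    have hpos : (0 : ℝ) < N + 1 := by positivity
    have hk : ∀ k : ℕ, k ≤ N + 1 →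
        φ (k / ((N : ℝ) + 1)) ≤ φ 0 + k * ((1 / ((N : ℝ) + 1)) ^ 2 / 2 * C) := by
      intro k
      induction k with
      | zero => simp
      | succ k ih =>
        intro hk
        have h1 := ih (by omega)
        have h2 := hstep (k / ((N : ℝ) + 1)) ((k + 1 : ℕ) / ((N : ℝ) + 1)) (by positivity)
          (by gcongr; simp) (by rw [div_le_one hpos]; exact_mod_cast hk)
        have e : ((k + 1 : ℕ) : ℝ) / ((N : ℝ) + 1) - k / ((N : ℝ) + 1) = 1 / ((N : ℝ) + 1) := by
          push_cast; ring
        rw [e] at h2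
        push_cast at h2 ⊢
        linarith
    have := hk (N + 1) le_rfl
    push_cast at this
    rw [div_self hpos.ne'] at this
    refine this.trans (le_of_eq ?_)
    field_simp
  have hlim : Filter.Tendsto (fun N : ℕ => φ 0 + C / 2 * (1 / ((N : ℝ) + 1))) Filter.atTop
      (nhds (φ 0 + C / 2 * 0)) :=
    (tendsto_one_div_add_atTop_nhds_zero_nat.const_mul _).const_add _
  have := ge_of_tendsto' hlim hN
  simp only [hφ, interpolation] at this
  norm_num at this
  rw [← sub_eq_add_neg] at this
  simpa [two_mul] using this

/-! ### Exponential Khintchine inequality for weighted involutions -/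

theorem weightedInvolution_mul_self {σ : ι → ι} (hσ : ∀ i, σ (σ i) = i) {t : ι → ℂ}
    (ht : ∀ i, t (σ i) = star (t i)) : weightedInvolution σ t * weightedInvolution σ t =
      diagonal fun i => ((‖t i‖ ^ 2 : ℝ) : ℂ) := by
  ext i k
  simp only [weightedInvolution, mul_apply, of_apply, ite_mul, zero_mul, Finset.sum_ite_eq',
    Finset.mem_univ, if_true, hσ, ht, diagonal_apply]
  by_cases h : k = i
  · subst h
    simp [← Complex.normSq_eq_norm_sq, Complex.mul_conj]
  · simp [h, Ne.symm h]

theorem trace_exp_conj_involutive {D : Matrix ι ι ℂ} (hD : D * D = 1) (A : Matrix ι ι ℂ) :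
    (NormedSpace.exp (D * A * D)).trace = (NormedSpace.exp A).trace := by
  have h : D⁻¹ = D := inv_eq_left_inv hD
  have e := exp_conj D A (IsUnit.of_mul_eq_one _ hD)
  rw [h] at e
  rw [e, trace_mul_comm, ← mul_assoc, hD, one_mul]

/-- A noncommutative Khintchine inequality, in exponential form, for weighted involutions that can
be sign-changed independently. -/
theorem trace_exp_sum_weightedInvolution_le {κ : Type*} [DecidableEq κ] (σ : κ → ι → ι)
    (hσ : ∀ j i, σ j (σ j i) = i) (t : κ → ι → ℂ) (ht : ∀ j i, t j (σ j i) = star (t j i))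
    (d : κ → ι → ℂ) (hd : ∀ k i, d k i * d k i = 1)
    (hdσ : ∀ k j i, d k (σ j i) = (if k = j then -1 else 1) * d k i)
    (s : Finset κ) (v : ι → ℝ) :
    (NormedSpace.exp (∑ j ∈ s, weightedInvolution (σ j) (t j) +
        diagonal fun i => (v i : ℂ))).trace.re ≤
      ∑ i, Real.exp (v i + 1 / 2 * ∑ j ∈ s, ‖t j i‖ ^ 2) := by
  have hdM : ∀ k j, diagonal (d k) * weightedInvolution (σ j) (t j) * diagonal (d k) =
      (if k = j then (-1 : ℂ) else 1) • weightedInvolution (σ j) (t j) := by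
    intro k j
    ext i l
    rw [mul_diagonal, diagonal_mul, smul_apply]
    simp only [weightedInvolution, of_apply]
    by_cases h : l = σ j i
    · subst h
      simp only [if_true, hdσ, smul_eq_mul]
      linear_combination (t j i * if k = j then -1 else 1) * hd k i
    · simp [h]
  have hherm : ∀ j, (weightedInvolution (σ j) (t j)).IsHermitian := fun j =>
    isHermitian_weightedInvolution (hσ j) (ht j)
  have hdiag : ∀ v : ι → ℝ, (diagonal fun i => (v i : ℂ)).IsHermitian := by
    intro v
    unfold IsHermitian
    rw [diagonal_conjTranspose]
    congr 1; funext i; simp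
  -- The diagonal `v` must vary: each removed involution leaves its square there.
  induction s using Finset.induction_on generalizing v with
  | empty =>
    rw [Finset.sum_empty, zero_add, exp_diagonal, trace_diagonal, Complex.re_sum]
    refine le_of_eq (Finset.sum_congr rfl fun i _ => ?_)
    rw [Pi.coe_exp]
    simp [← Complex.exp_eq_exp_ℂ, ← Complex.ofReal_exp]
  | insert k s hk ih =>
    set M := weightedInvolution (σ k) (t k) with hM
    set H := ∑ j ∈ s, weightedInvolution (σ j) (t j) + diagonal fun i => (v i : ℂ) with hH
    have hHh : H.IsHermitian := by
      refine IsHermitian.add ?_ (hdiag v)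
      unfold IsHermitian
      rw [conjTranspose_sum]
      exact Finset.sum_congr rfl fun j _ => hherm j
    have hDD : diagonal (d k) * diagonal (d k) = 1 := by
      rw [diagonal_mul_diagonal]; simp [hd]
    have hconj : diagonal (d k) * (H + M) * diagonal (d k) = H - M := by
      rw [mul_add, add_mul, hM, hdM, if_pos rfl, hH, mul_add, add_mul, Finset.mul_sum,
        Finset.sum_mul, diagonal_mul_diagonal, diagonal_mul_diagonal, sub_eq_add_neg, neg_one_smul]
      congr 2
      · refine Finset.sum_congr rfl fun j hj => ?_
        rw [hdM, if_neg (by rintro rfl; exact hk hj), one_smul]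
      · congr 1; funext i
        linear_combination (v i : ℂ) * hd k i
    -- Since `H - M` is conjugate to `H + M`, the two traces on the left are equal and the factor
    -- `2` cancels.
    have h1 := trace_exp_add_add_trace_exp_sub_le hHh (hherm k)
    rw [← hM, ← hconj, trace_exp_conj_involutive hDD] at h1
    have e1 : ∑ j ∈ insert k s, weightedInvolution (σ j) (t j) +
        (diagonal fun i => (v i : ℂ)) = H + M := by
      rw [Finset.sum_insert hk, hH, hM]; abel
    have e2 : H + (1 / 2 : ℝ) • (M * M) = ∑ j ∈ s, weightedInvolution (σ j) (t j) +
        diagonal fun i => ((v i + 1 / 2 * ‖t k i‖ ^ 2 : ℝ) : ℂ) := by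
      rw [hM, weightedInvolution_mul_self (hσ k) (ht k), hH, add_assoc]
      congr 1
      rw [← diagonal_smul, diagonal_add]
      congr 1; funext i
      simp
    rw [e1]
    have h2 := ih (fun i => v i + 1 / 2 * ‖t k i‖ ^ 2)
    rw [← e2] at h2
    refine le_trans (by linarith : _ ≤ _) (h2.trans (le_of_eq ?_))
    refine Finset.sum_congr rfl fun i _ => ?_
    rw [Finset.sum_insert hk]
    congr 1; ring

end Matrix

namespace Cube

/-! ### Rotations and the noise operator -/

open scoped Matrix

/-- The rotation of angle `θ / 2`, with rows and columns indexed by `{-1, 1}`. -/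
noncomputable def siteRotation (θ : ℝ) (y x : ℤˣ) : ℝ :=
  if y = x then Real.cos (θ / 2) else ((x : ℤ) : ℝ) * Real.sin (θ / 2)

/-- The tensor power of the rotation of angle `θ / 2`. -/
noncomputable def rotation {n : ℕ} (θ : ℝ) (y x : Cube n) : ℝ :=
  ∏ j, siteRotation θ (y j) (x j)

theorem sum_units {R : Type*} [AddCommMonoid R] (F : ℤˣ → R) : ∑ y : ℤˣ, F y = F 1 + F (-1) := by
  rw [show (Finset.univ : Finset ℤˣ) = {1, -1} from rfl, Finset.sum_pair (by decide)]

theorem sum_siteRotation_mul (θ : ℝ) (x x' : ℤˣ) :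
    ∑ y, siteRotation θ y x * siteRotation θ y x' = if x = x' then 1 else 0 := by
  rw [sum_units]
  have h := Real.sin_sq_add_cos_sq (θ / 2)
  have h1 : ¬ ((-1 : ℤˣ) = 1) := by decide
  have h2 : ¬ ((1 : ℤˣ) = -1) := by decide
  rcases Int.units_eq_one_or x with rfl | rfl <;> rcases Int.units_eq_one_or x' with rfl | rfl <;>
    simp [siteRotation, h1, h2] <;> linarith

theorem sum_mul_siteRotation_sq (θ : ℝ) (x : ℤˣ) :
    ∑ y : ℤˣ, ((y : ℤ) : ℝ) * siteRotation θ y x ^ 2 = ((x : ℤ) : ℝ) * Real.cos θ := by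
  rw [sum_units]
  have h := Real.cos_sq' (θ / 2)
  have h0 : Real.cos θ = 2 * Real.cos (θ / 2) ^ 2 - 1 := by
    rw [← Real.cos_two_mul]; ring_nf
  have h1 : ¬ ((-1 : ℤˣ) = 1) := by decide
  have h2 : ¬ ((1 : ℤˣ) = -1) := by decide
  rcases Int.units_eq_one_or x with rfl | rfl <;> simp [siteRotation, h1, h2, h0] <;> linarith

/-- Differentiating a rotation composes it with a quarter turn, which on `{-1, 1}` is a flip with a
sign; this is how discrete derivatives enter. -/
theorem hasDerivAt_siteRotation (θ : ℝ) (y x : ℤˣ) :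
    HasDerivAt (fun θ => siteRotation θ y x) (-(1 / 2) * ((y : ℤ) : ℝ) * siteRotation θ (-y) x)
      θ := by
  have hc : HasDerivAt (fun θ : ℝ => Real.cos (θ / 2)) (-Real.sin (θ / 2) * (1 / 2)) θ :=
    ((hasDerivAt_id θ).div_const 2).cos
  have hs : HasDerivAt (fun θ : ℝ => Real.sin (θ / 2)) (Real.cos (θ / 2) * (1 / 2)) θ :=
    ((hasDerivAt_id θ).div_const 2).sin
  have h1 : ¬ ((-1 : ℤˣ) = 1) := by decide
  have h2 : ¬ ((1 : ℤˣ) = -1) := by decide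
  rcases Int.units_eq_one_or x with rfl | rfl <;> rcases Int.units_eq_one_or y with rfl | rfl <;>
    simp only [siteRotation, h1, h2, if_true, if_false, neg_neg]
  · exact hc.congr_deriv (by push_cast; ring)
  · exact (hs.const_mul _).congr_deriv (by push_cast; ring)
  · exact (hs.const_mul _).congr_deriv (by push_cast; ring)
  · exact hc.congr_deriv (by push_cast; ring)

variable {n : ℕ}

theorem sum_rotation_mul (θ : ℝ) (x x' : Cube n) :
    ∑ y, rotation θ y x * rotation θ y x' = if x = x' then 1 else 0 := by
  simp only [rotation, ← Finset.prod_mul_distrib]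
  rw [← Fintype.piFinset_univ,
    ← Finset.prod_univ_sum (fun _ => Finset.univ)
      (fun j y => siteRotation θ y (x j) * siteRotation θ y (x' j))]
  simp only [sum_siteRotation_mul]
  split_ifs with h
  · simp [h]
  · obtain ⟨j, hj⟩ := Function.ne_iff.mp h
    exact Finset.prod_eq_zero (Finset.mem_univ j) (by simp [hj])

/-- Everything factors over coordinates: a site in `A` contributes `cos² (θ/2) - sin² (θ/2) = cos
θ`, any other site `1`. -/
theorem sum_walsh_mul_rotation_sq (θ : ℝ) (A : Finset (Fin n)) (x : Cube n) :
    ∑ y, walsh A y * ((rotation θ y x ^ 2 : ℝ) : ℂ) =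
      ((Real.cos θ ^ A.card : ℝ) : ℂ) * walsh A x := by
  have hw : ∀ y : Cube n, walsh A y =
      ((∏ j, (if j ∈ A then (((y j : ℤˣ) : ℤ) : ℝ) else 1) : ℝ) : ℂ) := by
    intro y
    rw [Finset.prod_ite_mem, Finset.univ_inter]
    simp [walsh]
  simp only [hw, ← Complex.ofReal_mul, ← Complex.ofReal_sum]
  congr 1
  simp only [rotation, ← Finset.prod_pow, ← Finset.prod_mul_distrib]
  rw [← Fintype.piFinset_univ,
    ← Finset.prod_univ_sum (fun _ => Finset.univ)
      (fun j (y : ℤˣ) => (if j ∈ A then ((y : ℤ) : ℝ) else 1) * siteRotation θ y (x j) ^ 2)]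
  have h : ∀ j, ∑ y : ℤˣ, (if j ∈ A then ((y : ℤ) : ℝ) else 1) * siteRotation θ y (x j) ^ 2 =
      (if j ∈ A then Real.cos θ else 1) * (if j ∈ A then (((x j : ℤˣ) : ℤ) : ℝ) else 1) := by
    intro j
    split_ifs
    · rw [sum_mul_siteRotation_sq, mul_comm]
    · have := sum_siteRotation_mul θ (x j) (x j)
      simpa [pow_two] using this
  simp only [h]
  rw [Finset.prod_mul_distrib, Finset.prod_ite_mem, Finset.univ_inter, Finset.prod_const]

theorem mul_flip_same (x : Cube n) (j : Fin n) : (x * flip j) j = -x j := by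
  simp [flip]

theorem mul_flip_of_ne (x : Cube n) {i j : Fin n} (h : i ≠ j) : (x * flip j) i = x i := by
  simp [flip, h]

theorem mul_flip_mul_flip (x : Cube n) (j : Fin n) : x * flip j * flip j = x := by
  funext i
  by_cases h : i = j
  · subst h; simp [flip]
  · simp [flip, h]

theorem hasDerivAt_rotation (θ : ℝ) (y x : Cube n) :
    HasDerivAt (fun θ => rotation θ y x)
      (∑ j, -(1 / 2) * (((y j : ℤˣ) : ℤ) : ℝ) * rotation θ (y * flip j) x) θ := by
  have h := HasDerivAt.fun_finsetProd (u := Finset.univ) (x := θ)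
    fun j _ => hasDerivAt_siteRotation θ (y j) (x j)
  refine h.congr_deriv ?_
  refine Finset.sum_congr rfl fun j _ => ?_
  have e : ∏ i ∈ Finset.univ.erase j, siteRotation θ ((y * flip j) i) (x i) =
      ∏ i ∈ Finset.univ.erase j, siteRotation θ (y i) (x i) :=
    Finset.prod_congr rfl fun i hi => by rw [mul_flip_of_ne y (Finset.ne_of_mem_erase hi)]
  rw [rotation, ← Finset.mul_prod_erase _ _ (Finset.mem_univ j), mul_flip_same, smul_eq_mul, e]
  ring

/-- The weights of the derivative of the rotated multiplication operator. -/
noncomputable def gradWeight (f : Cube n → ℂ) (j : Fin n) (y : Cube n) : ℂ :=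
  -(1 / 2) * (((y j : ℤˣ) : ℤ) : ℂ) * partialDeriv j f y

/-- The derivative in `θ` of the noise operator of parameter `cos θ`. -/
noncomputable def noiseDeriv (f : Cube n → ℂ) (θ : ℝ) (x : Cube n) : ℂ :=
  ∑ j, ∑ y, gradWeight f j y * (rotation θ y x * rotation θ (y * flip j) x : ℝ)

theorem sum_mul_flip (j : Fin n) (F : Cube n → ℂ) : ∑ y, F (y * flip j) = ∑ y, F y :=
  Equiv.sum_comp (Equiv.mulRight (flip j)) F

/-- The kernel is symmetric under `y ↦ y e_j` while `y_j` changes sign, so the two halves of `∂_j f`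
contribute equally. -/
theorem sum_gradWeight_mul (f : Cube n → ℂ) (θ : ℝ) (x : Cube n) (j : Fin n) :
    ∑ y, gradWeight f j y * (rotation θ y x * rotation θ (y * flip j) x : ℝ) =
      -∑ y, f y * (((y j : ℤˣ) : ℤ) : ℂ) * (rotation θ y x * rotation θ (y * flip j) x : ℝ) := by
  have h := sum_mul_flip j fun y => (1 / 2 : ℂ) * (((y j : ℤˣ) : ℤ) : ℂ) * f (y * flip j) *
    (rotation θ y x * rotation θ (y * flip j) x : ℝ)
  simp only [mul_flip_same, mul_flip_mul_flip] at h
  have e : ∀ y, gradWeight f j y * (rotation θ y x * rotation θ (y * flip j) x : ℝ) =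
      -(1 / 2 : ℂ) * (((y j : ℤˣ) : ℤ) : ℂ) * f y *
        (rotation θ y x * rotation θ (y * flip j) x : ℝ) +
      (1 / 2 : ℂ) * (((y j : ℤˣ) : ℤ) : ℂ) * f (y * flip j) *
        (rotation θ y x * rotation θ (y * flip j) x : ℝ) := by
    intro y
    rw [gradWeight, partialDeriv]; ring
  rw [Finset.sum_congr rfl fun y _ => e y, Finset.sum_add_distrib, ← h, ← Finset.sum_add_distrib,
    ← Finset.sum_neg_distrib]
  refine Finset.sum_congr rfl fun y _ => ?_
  push_cast
  ring

theorem hasDerivAt_noise (f : Cube n → ℂ) (θ : ℝ) (x : Cube n) :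
    HasDerivAt (fun θ => ∑ y, f y * ((rotation θ y x ^ 2 : ℝ) : ℂ)) (noiseDeriv f θ x) θ := by
  have h : HasDerivAt (fun θ => ∑ y, f y * ((rotation θ y x ^ 2 : ℝ) : ℂ)) _ θ :=
    HasDerivAt.fun_sum fun y (_ : y ∈ Finset.univ) =>
      ((hasDerivAt_rotation θ y x).fun_pow 2).ofReal_comp.const_mul (f y)
  convert h using 1
  simp only [noiseDeriv, sum_gradWeight_mul, ← Finset.sum_neg_distrib]
  rw [Finset.sum_comm]
  refine Finset.sum_congr rfl fun y _ => ?_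
  rw [Finset.mul_sum, Complex.ofReal_sum, Finset.mul_sum]
  refine Finset.sum_congr rfl fun j _ => ?_
  push_cast
  ring

theorem sum_mul_rotation_sq (f : Cube n → ℂ) (θ : ℝ) (x : Cube n) :
    ∑ y, f y * ((rotation θ y x ^ 2 : ℝ) : ℂ) =
      ∑ A, walshCoeff f A * walsh A x * ((Real.cos θ ^ A.card : ℝ) : ℂ) := by
  have h : ∀ y, f y * ((rotation θ y x ^ 2 : ℝ) : ℂ) =
      ∑ A, walshCoeff f A * (walsh A y * ((rotation θ y x ^ 2 : ℝ) : ℂ)) := by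
    intro y
    conv_lhs => rw [walsh_expansion f y, Finset.sum_mul]
    exact Finset.sum_congr rfl fun A _ => by ring
  rw [Finset.sum_congr rfl fun y _ => h y, Finset.sum_comm]
  refine Finset.sum_congr rfl fun A _ => ?_
  rw [← Finset.mul_sum, sum_walsh_mul_rotation_sq]
  ring

theorem noiseDeriv_eq (f : Cube n → ℂ) (θ : ℝ) (x : Cube n) :
    noiseDeriv f θ x = -∑ A, walshCoeff f A * walsh A x *
      ((A.card * Real.cos θ ^ (A.card - 1) * Real.sin θ : ℝ) : ℂ) := by
  have h : HasDerivAt (fun θ => ∑ A, walshCoeff f A * walsh A x *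
      ((Real.cos θ ^ A.card : ℝ) : ℂ)) _ θ :=
    HasDerivAt.fun_sum fun A (_ : A ∈ Finset.univ) =>
      ((Real.hasDerivAt_cos θ).fun_pow A.card).ofReal_comp.const_mul (walshCoeff f A * walsh A x)
  have h2 := hasDerivAt_noise f θ x
  simp only [sum_mul_rotation_sq] at h2
  rw [h2.unique h, ← Finset.sum_neg_distrib]
  refine Finset.sum_congr rfl fun A _ => ?_
  push_cast
  ring

theorem continuous_noiseDeriv (f : Cube n → ℂ) (x : Cube n) :
    Continuous fun θ => noiseDeriv f θ x := by
  simp only [noiseDeriv_eq]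
  fun_prop

theorem norm_gradWeight (f : Cube n → ℂ) (j : Fin n) (y : Cube n) :
    ‖gradWeight f j y‖ = 1 / 2 * ‖partialDeriv j f y‖ := by
  rw [gradWeight]
  rcases Int.units_eq_one_or (y j) with h | h <;> simp [h]

/-- Both `y_j` and `∂_j f` change sign under the flip. This invariance makes the doubled weighted
flips Hermitian. -/
theorem gradWeight_mul_flip (f : Cube n → ℂ) (j : Fin n) (y : Cube n) :
    gradWeight f j (y * flip j) = gradWeight f j y := by
  simp only [gradWeight, partialDeriv, mul_flip_same, mul_flip_mul_flip]
  push_cast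
  ring

/-! ### Uniform exponential bound for the noise derivative -/

theorem exists_phase (z : ℂ) : ∃ ω : ℂ, star ω * ω = 1 ∧ ω * z = ‖z‖ := by
  by_cases hz : z = 0
  · exact ⟨1, by simp, by simp [hz]⟩
  · have hn : (‖z‖ : ℂ) ≠ 0 := by simpa using hz
    have h := Complex.conj_mul' z
    refine ⟨star z / ‖z‖, ?_, ?_⟩
    · simp only [RCLike.star_def, map_div₀, Complex.conj_conj, Complex.conj_ofReal]
      field_simp
      linear_combination h
    · simp only [RCLike.star_def]
      field_simp
      exact h

/-- The exponential gradient bound for the derivative of the noise operator. -/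
theorem sum_exp_noiseDeriv_le (f : Cube n → ℂ) (θ c : ℝ) :
    ∑ x, Real.exp (c * ‖noiseDeriv f θ x‖) ≤
      2 * ∑ x, Real.exp (c ^ 2 / 8 * gradLength f x ^ 2) := by
  choose ω hω hωg using fun x => exists_phase (noiseDeriv f θ x)
  -- The extra sign is the block index of the doubling: the off-diagonal blocks are the weighted
  -- flip and its adjoint.
  set σ : Fin n → Cube n × ℤˣ → Cube n × ℤˣ := fun j p => (p.1 * flip j, -p.2) with hσd
  set t : Fin n → Cube n × ℤˣ → ℂ := fun j p =>
    if p.2 = 1 then c * gradWeight f j p.1 else star (c * gradWeight f j p.1) with htd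
  have hσ : ∀ j p, σ j (σ j p) = p := fun j p => by
    simp [hσd, mul_flip_mul_flip]
  have h1 : ¬ ((-1 : ℤˣ) = 1) := by decide
  have ht : ∀ j p, t j (σ j p) = star (t j p) := by
    rintro j ⟨x, s⟩
    rcases Int.units_eq_one_or s with rfl | rfl <;> simp [htd, hσd, gradWeight_mul_flip, h1]
  set d : Fin n → Cube n × ℤˣ → ℂ := fun k p => (((p.1 k : ℤˣ) : ℤ) : ℂ) with hdd
  have hd : ∀ k p, d k p * d k p = 1 := by
    intro k p
    rcases Int.units_eq_one_or (p.1 k) with h | h <;> simp [hdd, h]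
  have hdσ : ∀ k j p, d k (σ j p) = (if k = j then -1 else 1) * d k p := by
    intro k j p
    by_cases h : k = j
    · subst h; simp only [hdd, hσd, mul_flip_same]; simp
    · simp only [hdd, hσd, mul_flip_of_ne p.1 h, h]; simp
  have key := Matrix.trace_exp_sum_weightedInvolution_le σ hσ t ht d hd hdσ Finset.univ
    (fun _ => 0)
  have hz : (Matrix.diagonal fun _ : Cube n × ℤˣ => ((0 : ℝ) : ℂ)) = 0 := by simp
  rw [hz, add_zero] at key
  set M := ∑ j, Matrix.weightedInvolution (σ j) (t j) with hM
  have hMh : M.IsHermitian := by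
    unfold Matrix.IsHermitian
    rw [hM, Matrix.conjTranspose_sum]
    exact Finset.sum_congr rfl fun j _ => Matrix.isHermitian_weightedInvolution (hσ j) (ht j)
  set τ : ℝ := (Real.sqrt 2)⁻¹ with hτ
  have hτ2 : (τ : ℂ) * τ = 1 / 2 := by
    rw [← Complex.ofReal_mul, hτ, ← mul_inv, Real.mul_self_sqrt (by norm_num)]
    simp
  -- The columns are `(R e_x, ± ω_x R e_x)/√2`. The phase `ω_x` makes the corresponding diagonal
  -- entries of the doubled matrix equal to `± c ‖noiseDeriv f θ x‖`.
  set V : Matrix (Cube n × ℤˣ) (Cube n × ℤˣ) ℂ := Matrix.of fun p q =>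
    (rotation θ p.1 q.1 : ℂ) * τ * (if p.2 = 1 then 1 else (((q.2 : ℤˣ) : ℤ) : ℂ) * ω q.1)
    with hV
  have hunit : Vᴴ * V = 1 := by
    ext ⟨x, r⟩ ⟨x', r'⟩
    rw [Matrix.mul_apply, Fintype.sum_prod_type, Matrix.one_apply]
    have e : ∀ y, ∑ s, Vᴴ (x, r) (y, s) * V (y, s) (x', r') =
        ((rotation θ y x * rotation θ y x' : ℝ) : ℂ) *
          (1 / 2 * (1 + ((r : ℤ) : ℂ) * ((r' : ℤ) : ℂ) * (star (ω x) * ω x'))) := by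
      intro y
      rw [sum_units]
      simp only [hV, Matrix.conjTranspose_apply, Matrix.of_apply, if_true, h1, if_false,
        RCLike.star_def, map_mul, map_one, Complex.conj_ofReal, map_intCast, Complex.ofReal_mul]
      rw [← hτ2]; ring
    rw [Finset.sum_congr rfl fun y _ => e y, ← Finset.sum_mul, ← Complex.ofReal_sum,
      sum_rotation_mul]
    by_cases hx : x = x'
    · subst hx
      rw [hω]
      have h2 : ¬ ((1 : ℤˣ) = -1) := by decide
      rcases Int.units_eq_one_or r with rfl | rfl <;>
        rcases Int.units_eq_one_or r' with rfl | rfl <;> simp [h1, h2] <;> norm_num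
    · simp [hx]
  have hdiag : ∀ k, (Vᴴ * M * V) k k =
      (((k.2 : ℤ) : ℝ) * (c * ‖noiseDeriv f θ k.1‖) : ℝ) := by
    rintro ⟨x, r⟩
    have e : ∀ j, (Vᴴ * Matrix.weightedInvolution (σ j) (t j) * V) (x, r) (x, r) =
        ((r : ℤ) : ℂ) * c * (1 / 2) * (ω x *
          (∑ y, gradWeight f j y * (rotation θ y x * rotation θ (y * flip j) x : ℝ)) +
        star (ω x * ∑ y, gradWeight f j y *
          (rotation θ y x * rotation θ (y * flip j) x : ℝ))) := by
      intro j
      rw [Matrix.mul_assoc, Matrix.mul_apply]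
      have e2 : ∀ p, (Matrix.weightedInvolution (σ j) (t j) * V) p (x, r) =
          t j p * V (σ j p) (x, r) := by
        intro p
        simp [Matrix.mul_apply, Matrix.weightedInvolution]
      rw [Finset.sum_congr rfl fun p _ => by rw [e2], Fintype.sum_prod_type, star_mul', star_sum,
        Finset.mul_sum, Finset.mul_sum, ← Finset.sum_add_distrib, Finset.mul_sum]
      refine Finset.sum_congr rfl fun y _ => ?_
      rw [sum_units]
      simp only [hV, htd, hσd, Matrix.conjTranspose_apply, Matrix.of_apply, if_true, h1, if_false,
        RCLike.star_def, map_mul, map_one, Complex.conj_ofReal, map_intCast, Complex.ofReal_mul,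
        neg_neg]
      rw [← hτ2]; ring
    have e3 : (Vᴴ * M * V) (x, r) (x, r) =
        ∑ j, (Vᴴ * Matrix.weightedInvolution (σ j) (t j) * V) (x, r) (x, r) := by
      rw [hM, Finset.mul_sum, Finset.sum_mul, Matrix.sum_apply]
    rw [e3, Finset.sum_congr rfl fun j _ => e j, ← Finset.mul_sum, Finset.sum_add_distrib,
      ← star_sum, ← Finset.mul_sum]
    change _ * (ω x * noiseDeriv f θ x + star (ω x * noiseDeriv f θ x)) = _
    rw [hωg]
    simp only [RCLike.star_def, Complex.conj_ofReal]
    push_cast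
    ring
  have hp := Matrix.sum_exp_le_trace_exp hMh hunit _ hdiag
  rw [Fintype.sum_prod_type] at hp
  -- Only the columns with sign `+1` are kept; the other exponentials are dropped as nonnegative.
  have hl : ∑ x, Real.exp (c * ‖noiseDeriv f θ x‖) ≤ ∑ x : Cube n, ∑ r : ℤˣ,
      Real.exp ((((x, r).2 : ℤ) : ℝ) * (c * ‖noiseDeriv f θ (x, r).1‖)) := by
    refine Finset.sum_le_sum fun x _ => ?_
    rw [sum_units]
    simp [Real.exp_nonneg]
  refine hl.trans (hp.trans (key.trans (le_of_eq ?_)))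
  rw [Fintype.sum_prod_type, Finset.mul_sum]
  refine Finset.sum_congr rfl fun x _ => ?_
  have hn : ∀ s : ℤˣ, 1 / 2 * ∑ j, ‖t j (x, s)‖ ^ 2 = c ^ 2 / 8 * gradLength f x ^ 2 := by
    intro s
    have : ∀ j, ‖t j (x, s)‖ ^ 2 = c ^ 2 / 4 * ‖partialDeriv j f x‖ ^ 2 := by
      intro j
      have : ‖t j (x, s)‖ = |c| * (1 / 2 * ‖partialDeriv j f x‖) := by
        rw [← norm_gradWeight]
        simp only [htd]
        split_ifs <;> simp
      rw [this, mul_pow, sq_abs]; ring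
    simp only [this]
    rw [← Finset.mul_sum, gradLength,
      Real.sq_sqrt (Finset.sum_nonneg fun j _ => by positivity)]
    ring
  rw [sum_units]
  simp only [hn, zero_add]
  ring

/-! ### Integral representations over the angle -/

open MeasureTheory Set

/-- The only singularity is at `0`, where `-log cos θ ≥ 1 - cos θ ≥ 2θ²/π²` gives a majorant of
order `θ^(-2α)`, integrable as `2α < 1`. -/
theorem integrableOn_neg_log_cos_rpow {α : ℝ} (h0 : 0 ≤ α) (h1 : α < 1 / 2) :
    IntegrableOn (fun θ : ℝ => (-Real.log (Real.cos θ)) ^ (-α)) (Icc 0 (Real.pi / 2)) := by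
  rw [integrableOn_Icc_iff_integrableOn_Ioo]
  have hg : IntegrableOn (fun θ : ℝ => (2 / Real.pi ^ 2) ^ (-α) * θ ^ (-(2 * α)))
      (Ioo 0 (Real.pi / 2)) :=
    ((intervalIntegral.integrableOn_Ioo_rpow_iff Real.pi_div_two_pos).mpr (by linarith)).const_mul _
  refine Integrable.mono' hg ?_ ?_
  · refine Measurable.aestronglyMeasurable ?_
    fun_prop
  · refine (ae_restrict_iff' measurableSet_Ioo).mpr (Filter.Eventually.of_forall fun θ hθ => ?_)
    have hpi := Real.pi_pos
    have hc : 0 < Real.cos θ := Real.cos_pos_of_mem_Ioo ⟨by linarith [hθ.1], hθ.2⟩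
    have hb := Real.cos_le_one_sub_mul_cos_sq (x := θ)
      (by rw [abs_of_pos hθ.1]; linarith [hθ.2])
    have hl := Real.log_le_sub_one_of_pos hc
    have hθ2 : 0 < 2 / Real.pi ^ 2 * θ ^ 2 := by have := hθ.1; positivity
    have hle : 2 / Real.pi ^ 2 * θ ^ 2 ≤ -Real.log (Real.cos θ) := by linarith
    rw [Real.norm_of_nonneg (Real.rpow_nonneg (hθ2.le.trans hle) _)]
    refine (Real.rpow_le_rpow_of_nonpos hθ2 hle (by linarith)).trans (le_of_eq ?_)
    rw [Real.mul_rpow (by positivity) (by positivity), ← Real.rpow_natCast θ,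
      ← Real.rpow_mul hθ.1.le]
    congr 2
    push_cast; ring

theorem image_neg_log_cos :
    (fun θ => -Real.log (Real.cos θ)) '' Ioo 0 (Real.pi / 2) = Ioi 0 := by
  have hpi := Real.pi_pos
  ext u
  simp only [mem_image, mem_Ioo, mem_Ioi]
  constructor
  · rintro ⟨θ, ⟨h0, h1⟩, rfl⟩
    have hc : 0 < Real.cos θ := Real.cos_pos_of_mem_Ioo ⟨by linarith, h1⟩
    have hc1 : Real.cos θ < 1 := by
      have := Real.cos_lt_cos_of_nonneg_of_le_pi le_rfl (by linarith) h0
      simpa using this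
    linarith [Real.log_neg hc hc1]
  · intro hu
    have h1 : Real.exp (-u) < 1 := by simpa using hu
    refine ⟨Real.arccos (Real.exp (-u)), ⟨Real.arccos_pos.mpr h1,
      Real.arccos_lt_pi_div_two.mpr (Real.exp_pos _)⟩, ?_⟩
    rw [Real.cos_arccos (by linarith [Real.exp_pos (-u)]) h1.le, Real.log_exp, neg_neg]

/-- The substitution `t = -log cos θ` turns the integral into `∫ t^(-α) k e^(-kt) dt` over `(0, ∞)`,
a Gamma integral. -/
theorem integral_neg_log_cos_rpow_mul {α : ℝ} (h0 : 0 < α) (h1 : α < 1) (k : ℕ) :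
    ∫ θ in Icc 0 (Real.pi / 2), (-Real.log (Real.cos θ)) ^ (-α) *
      (k * Real.cos θ ^ (k - 1) * Real.sin θ) = (k : ℝ) ^ α * Real.Gamma (1 - α) := by
  rcases Nat.eq_zero_or_pos k with rfl | hk
  · simp [Real.zero_rpow h0.ne']
  have hpi := Real.pi_pos
  have hkp : (0 : ℝ) < k := by exact_mod_cast hk
  rw [integral_Icc_eq_integral_Ioo]
  have hderiv : ∀ θ ∈ Ioo 0 (Real.pi / 2),
      HasDerivWithinAt (fun θ => -Real.log (Real.cos θ)) (Real.sin θ / Real.cos θ)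
        (Ioo 0 (Real.pi / 2)) θ := by
    intro θ hθ
    have hc : 0 < Real.cos θ := Real.cos_pos_of_mem_Ioo ⟨by linarith [hθ.1], hθ.2⟩
    have := ((Real.hasDerivAt_cos θ).log hc.ne').neg.hasDerivWithinAt (s := Ioo 0 (Real.pi / 2))
    exact this.congr_deriv (by ring)
  have hinj : InjOn (fun θ => -Real.log (Real.cos θ)) (Ioo 0 (Real.pi / 2)) := by
    intro θ hθ η hη h
    have hc : 0 < Real.cos θ := Real.cos_pos_of_mem_Ioo ⟨by linarith [hθ.1], hθ.2⟩
    have hc' : 0 < Real.cos η := Real.cos_pos_of_mem_Ioo ⟨by linarith [hη.1], hη.2⟩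
    exact Real.injOn_cos ⟨hθ.1.le, by linarith [hθ.2]⟩ ⟨hη.1.le, by linarith [hη.2]⟩
      (Real.log_injOn_pos hc hc' (neg_injective h))
  have h := integral_image_eq_integral_abs_deriv_smul measurableSet_Ioo hderiv hinj
    (fun t => t ^ ((1 - α) - 1) * Real.exp (-(k * t)))
  rw [image_neg_log_cos, Real.integral_rpow_mul_exp_neg_mul_Ioi (by linarith) hkp] at h
  have e : ∫ θ in Ioo 0 (Real.pi / 2), (-Real.log (Real.cos θ)) ^ (-α) *
      (k * Real.cos θ ^ (k - 1) * Real.sin θ) =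
      k * ((1 / (k : ℝ)) ^ (1 - α) * Real.Gamma (1 - α)) := by
    rw [h, ← integral_const_mul]
    refine setIntegral_congr_fun measurableSet_Ioo fun θ hθ => ?_
    have hc : 0 < Real.cos θ := Real.cos_pos_of_mem_Ioo ⟨by linarith [hθ.1], hθ.2⟩
    have hs : 0 < Real.sin θ := Real.sin_pos_of_pos_of_lt_pi hθ.1 (by linarith [hθ.2])
    have hexp : Real.exp (-(k * -Real.log (Real.cos θ))) = Real.cos θ ^ k := by
      rw [mul_neg, neg_neg, mul_comm, Real.exp_mul, Real.exp_log hc, Real.rpow_natCast]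
    have hpow : Real.cos θ ^ k = Real.cos θ ^ (k - 1) * Real.cos θ := by
      rw [← pow_succ, Nat.sub_add_cancel hk]
    simp only [hexp, hpow, smul_eq_mul]
    rw [abs_of_pos (div_pos hs hc), show (1 - α) - 1 = -α by ring]
    field_simp
  rw [e, one_div, Real.inv_rpow hkp.le, ← Real.rpow_neg hkp.le, ← mul_assoc]
  congr 1
  nth_rewrite 1 [← Real.rpow_one (k : ℝ)]
  rw [← Real.rpow_add hkp]
  congr 1; ring

theorem integral_mul_noiseDeriv (f : Cube n → ℂ) (x : Cube n) {w : ℝ → ℝ}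
    (hw : IntegrableOn w (Icc 0 (Real.pi / 2))) :
    ∫ θ in Icc 0 (Real.pi / 2), (w θ : ℂ) * noiseDeriv f θ x =
      -∑ A, walshCoeff f A * walsh A x * ((∫ θ in Icc 0 (Real.pi / 2),
        w θ * (A.card * Real.cos θ ^ (A.card - 1) * Real.sin θ) : ℝ) : ℂ) := by
  have hi : ∀ k : ℕ, IntegrableOn (fun θ => w θ * (k * Real.cos θ ^ (k - 1) * Real.sin θ))
      (Icc 0 (Real.pi / 2)) := fun k =>
    hw.mul_continuousOn (by fun_prop) isCompact_Icc
  have e : ∀ θ, (w θ : ℂ) * noiseDeriv f θ x = -∑ A, walshCoeff f A * walsh A x *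
      ((w θ * (A.card * Real.cos θ ^ (A.card - 1) * Real.sin θ) : ℝ) : ℂ) := by
    intro θ
    rw [noiseDeriv_eq, mul_neg, Finset.mul_sum]
    congr 1
    refine Finset.sum_congr rfl fun A _ => ?_
    push_cast; ring
  simp only [e]
  rw [integral_neg, integral_finsetSum _ fun A _ => ((hi A.card).ofReal).const_mul _]
  congr 1
  refine Finset.sum_congr rfl fun A _ => ?_
  rw [integral_const_mul, integral_complex_ofReal]

theorem laplacianPow_eq_integral (f : Cube n → ℂ) (x : Cube n) {α : ℝ} (h0 : 0 < α)
    (h1 : α < 1 / 2) :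
    laplacianPow α f x = -(((4 : ℝ) ^ α / Real.Gamma (1 - α) : ℝ) : ℂ) *
      ∫ θ in Icc 0 (Real.pi / 2),
        (((-Real.log (Real.cos θ)) ^ (-α) : ℝ) : ℂ) * noiseDeriv f θ x := by
  have hG : Real.Gamma (1 - α) ≠ 0 := (Real.Gamma_pos_of_pos (by linarith)).ne'
  rw [integral_mul_noiseDeriv f x (integrableOn_neg_log_cos_rpow h0.le h1), neg_mul_neg,
    Finset.mul_sum]
  refine Finset.sum_congr rfl fun A _ => ?_
  rw [integral_neg_log_cos_rpow_mul h0 (by linarith), Real.mul_rpow (by norm_num) (by positivity)]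
  have hG' : (Real.Gamma (1 - α) : ℂ) ≠ 0 := by exact_mod_cast hG
  push_cast
  field_simp

/-- The noise operator is the identity at `θ = 0` and the expectation at `θ = π/2`. -/
theorem sub_expect_eq_integral (f : Cube n → ℂ) (x : Cube n) :
    f x - 𝔼 y, f y = -∫ θ in Icc 0 (Real.pi / 2), noiseDeriv f θ x := by
  have hFTC := intervalIntegral.integral_eq_sub_of_hasDerivAt (a := 0) (b := Real.pi / 2)
    (fun θ _ => hasDerivAt_noise f θ x) ((continuous_noiseDeriv f x).intervalIntegrable _ _)
  rw [intervalIntegral.integral_of_le Real.pi_div_two_pos.le,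
    ← integral_Icc_eq_integral_Ioc] at hFTC
  rw [hFTC]
  simp only [sum_mul_rotation_sq]
  have e1 : ∑ A, walshCoeff f A * walsh A x * ((Real.cos 0 ^ A.card : ℝ) : ℂ) = f x := by
    conv_rhs => rw [walsh_expansion f x]
    simp
  have e2 : ∑ A : Finset (Fin n), walshCoeff f A * walsh A x *
      ((Real.cos (Real.pi / 2) ^ A.card : ℝ) : ℂ) = 𝔼 y, f y := by
    rw [Finset.sum_eq_single ∅]
    · simp [walshCoeff, walsh]
    · intro A _ hA
      simp [Finset.card_ne_zero.mpr (Finset.nonempty_iff_ne_empty.mpr hA)]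
    · simp
  rw [e1, e2]; ring

/-- Averaging over the angle of the gradient bound for the derivative of the noise operator. -/
theorem expect_exp_norm_le (f h : Cube n → ℂ) {w : ℝ → ℝ}
    (hw : IntegrableOn w (Icc 0 (Real.pi / 2))) (hw0 : ∀ θ ∈ Icc 0 (Real.pi / 2), 0 ≤ w θ)
    (hh : ∀ x, ‖h x‖ ≤ ∫ θ in Icc 0 (Real.pi / 2), w θ * ‖noiseDeriv f θ x‖) :
    𝔼 x, Real.exp ‖h x‖ ≤ 2 * 𝔼 x,
      Real.exp ((∫ θ in Icc 0 (Real.pi / 2), w θ) ^ 2 / 8 * gradLength f x ^ 2) := by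
  set W := ∫ θ in Icc 0 (Real.pi / 2), w θ with hW
  have hcn : ∀ x, Continuous fun θ => ‖noiseDeriv f θ x‖ := fun x =>
    (continuous_noiseDeriv f x).norm
  have hi1 : ∀ x, IntegrableOn (fun θ => w θ * ‖noiseDeriv f θ x‖) (Icc 0 (Real.pi / 2)) :=
    fun x => hw.mul_continuousOn (hcn x).continuousOn isCompact_Icc
  have hi2 : ∀ x, IntegrableOn (fun θ => w θ * Real.exp (W * ‖noiseDeriv f θ x‖))
      (Icc 0 (Real.pi / 2)) := fun x =>
    hw.mul_continuousOn
      (Real.continuous_exp.comp ((hcn x).const_mul W)).continuousOn isCompact_Icc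
  have hpt : ∀ x, W * Real.exp ‖h x‖ ≤
      ∫ θ in Icc 0 (Real.pi / 2), w θ * Real.exp (W * ‖noiseDeriv f θ x‖) := by
    intro x
    have hW0 : 0 ≤ W := setIntegral_nonneg measurableSet_Icc hw0
    -- Jensen's inequality by hand: the tangent line of `exp` at `‖h x‖` is integrated against `w`,
    -- so `w` need not be normalised.
    have hle : ∫ θ in Icc 0 (Real.pi / 2), (Real.exp ‖h x‖ * (1 - ‖h x‖) * w θ +
        Real.exp ‖h x‖ * W * (w θ * ‖noiseDeriv f θ x‖)) ≤
        ∫ θ in Icc 0 (Real.pi / 2), w θ * Real.exp (W * ‖noiseDeriv f θ x‖) := by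
      refine setIntegral_mono_on ((hw.const_mul _).add ((hi1 x).const_mul _)) (hi2 x)
        measurableSet_Icc fun θ hθ => ?_
      have h1 := Real.add_one_le_exp (W * ‖noiseDeriv f θ x‖ - ‖h x‖)
      have h2 : Real.exp (W * ‖noiseDeriv f θ x‖) =
          Real.exp (W * ‖noiseDeriv f θ x‖ - ‖h x‖) * Real.exp ‖h x‖ := by
        rw [← Real.exp_add]; simp
      rw [h2]
      have h3 := mul_le_mul_of_nonneg_left h1
        (mul_nonneg (hw0 θ hθ) (Real.exp_pos ‖h x‖).le)
      linarith
    rw [integral_add (hw.const_mul _) ((hi1 x).const_mul _), integral_const_mul,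
      integral_const_mul, ← hW] at hle
    have h4 := mul_le_mul_of_nonneg_left (hh x) (mul_nonneg (Real.exp_pos ‖h x‖).le hW0)
    linarith
  have hsum : ∑ x, Real.exp ‖h x‖ ≤ 2 * ∑ x, Real.exp (W ^ 2 / 8 * gradLength f x ^ 2) := by
    have hW0 : 0 ≤ W := setIntegral_nonneg measurableSet_Icc hw0
    rcases hW0.eq_or_lt with hWz | hWp
    -- A weight of zero mass vanishes almost everywhere, which forces `h = 0`.
    · have hz : ∀ x, ‖h x‖ = 0 := by
        intro x
        have hae : w =ᵐ[volume.restrict (Icc 0 (Real.pi / 2))] 0 :=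
          (setIntegral_eq_zero_iff_of_nonneg_ae
            ((ae_restrict_iff' measurableSet_Icc).mpr (Filter.Eventually.of_forall hw0)) hw).mp
            hWz.symm
        have h0 : ∫ θ in Icc 0 (Real.pi / 2), w θ * ‖noiseDeriv f θ x‖ = 0 := by
          refine (integral_congr_ae ?_).trans (integral_zero _ _)
          filter_upwards [hae] with θ hθ
          simp [hθ]
        exact le_antisymm ((hh x).trans h0.le) (norm_nonneg _)
      simp only [hz, ← hWz]
      simp
    · refine le_of_mul_le_mul_left ?_ hWp
      rw [Finset.mul_sum]
      refine (Finset.sum_le_sum fun x _ => hpt x).trans ?_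
      rw [← integral_finsetSum _ fun x _ => hi2 x]
      have hle : ∫ θ in Icc 0 (Real.pi / 2), ∑ x, w θ * Real.exp (W * ‖noiseDeriv f θ x‖) ≤
          ∫ θ in Icc 0 (Real.pi / 2),
            w θ * (2 * ∑ x, Real.exp (W ^ 2 / 8 * gradLength f x ^ 2)) := by
        refine setIntegral_mono_on (integrable_finsetSum _ fun x _ => hi2 x) (hw.mul_const _)
          measurableSet_Icc fun θ hθ => ?_
        rw [← Finset.mul_sum]
        exact mul_le_mul_of_nonneg_left (sum_exp_noiseDeriv_le f θ W) (hw0 θ hθ)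
      rwa [integral_mul_const, ← hW] at hle
  rw [Fintype.expect_eq_sum_div_card, Fintype.expect_eq_sum_div_card, ← mul_div_assoc]
  gcongr

theorem expect_exp_gradLength_le (f : Cube n → ℂ) {c : ℝ} (hc : 0 ≤ c) :
    𝔼 x, Real.exp (c * gradLength f x ^ 2) ≤ Real.exp (c * (⨆ x, gradLength f x) ^ 2) := by
  refine Finset.expect_le Finset.univ_nonempty fun x _ => ?_
  have h1 : gradLength f x ≤ ⨆ x, gradLength f x := le_ciSup (Set.finite_range _).bddAbove x
  have h2 : 0 ≤ gradLength f x := Real.sqrt_nonneg _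
  gcongr

/-! ### The two exponential bounds -/

theorem constK_eq (α : ℝ) : constK α = 1 / Real.Gamma (1 - α) *
    ∫ θ in Icc 0 (Real.pi / 2), (-Real.log (Real.cos θ)) ^ (-α) := by
  rw [constK]
  congr 1
  refine setIntegral_congr_fun measurableSet_Icc fun θ hθ => ?_
  exact abs_of_nonneg (Real.rpow_nonneg (neg_nonneg.mpr (Real.log_nonpos
    (Real.cos_nonneg_of_neg_pi_div_two_le_of_le (by linarith [Real.pi_pos, hθ.1]) hθ.2)
    (Real.cos_le_one θ))) _)

theorem expect_exp_norm_sub_expect_le (f : Cube n → ℂ) :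
    𝔼 x, Real.exp ‖f x - 𝔼 y, f y‖ ≤
      2 * 𝔼 x, Real.exp (Real.pi ^ 2 / 32 * gradLength f x ^ 2) := by
  have h := expect_exp_norm_le f (fun x => f x - 𝔼 y, f y) (w := fun _ => 1)
    (by simp) (fun _ _ => zero_le_one) (fun x => by
      simp only [one_mul]
      rw [sub_expect_eq_integral, norm_neg]
      exact norm_integral_le_integral_norm _)
  have e : (∫ _ in Icc 0 (Real.pi / 2), (1 : ℝ)) ^ 2 / 8 = Real.pi ^ 2 / 32 := by
    rw [setIntegral_const, measureReal_def, Real.volume_Icc,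
      ENNReal.toReal_ofReal (by linarith [Real.pi_pos]), smul_eq_mul]
    ring
  rwa [e] at h

theorem expect_exp_norm_laplacianPow_le (f : Cube n → ℂ) {α : ℝ} (h0 : 0 < α) (h1 : α < 1 / 2) :
    𝔼 x, Real.exp ‖laplacianPow α f x‖ ≤
      2 * 𝔼 x, Real.exp (1 / 2 * constK α ^ 2 * gradLength f x ^ 2) := by
  have hG : 0 < Real.Gamma (1 - α) := Real.Gamma_pos_of_pos (by linarith)
  set C : ℝ := (4 : ℝ) ^ α / Real.Gamma (1 - α) with hC
  have hC0 : 0 < C := by positivity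
  have hw0 : ∀ θ ∈ Icc 0 (Real.pi / 2), 0 ≤ (-Real.log (Real.cos θ)) ^ (-α) := fun θ hθ =>
    Real.rpow_nonneg (neg_nonneg.mpr (Real.log_nonpos
      (Real.cos_nonneg_of_neg_pi_div_two_le_of_le (by linarith [Real.pi_pos, hθ.1]) hθ.2)
      (Real.cos_le_one θ))) _
  have h := expect_exp_norm_le f (laplacianPow α f)
    (w := fun θ => C * (-Real.log (Real.cos θ)) ^ (-α))
    ((integrableOn_neg_log_cos_rpow h0.le h1).const_mul _)
    (fun θ hθ => mul_nonneg hC0.le (hw0 θ hθ)) (fun x => by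
      rw [laplacianPow_eq_integral f x h0 h1, norm_mul, norm_neg, Complex.norm_real,
        Real.norm_of_nonneg hC0.le]
      simp only [mul_assoc]
      rw [integral_const_mul]
      gcongr
      refine (norm_integral_le_integral_norm _).trans (le_of_eq ?_)
      refine setIntegral_congr_fun measurableSet_Icc fun θ hθ => ?_
      simp only [norm_mul, Complex.norm_real]
      rw [Real.norm_of_nonneg (hw0 θ hθ)])
  refine h.trans ?_
  have e : ∫ θ in Icc 0 (Real.pi / 2), C * (-Real.log (Real.cos θ)) ^ (-α) =
      (4 : ℝ) ^ α * constK α := by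
    rw [integral_const_mul, constK_eq, hC]; ring
  -- The total mass is `4^α K_α`, and `α < 1/2` gives `(4^α)²/8 ≤ 1/2`.
  have h4 : (4 : ℝ) ^ α ≤ 2 := by
    calc (4 : ℝ) ^ α ≤ (4 : ℝ) ^ (1 / 2 : ℝ) :=
          Real.rpow_le_rpow_of_exponent_le (by norm_num) h1.le
      _ = 2 := by
        rw [← Real.sqrt_eq_rpow, show (4 : ℝ) = 2 ^ 2 by norm_num, Real.sqrt_sq (by norm_num)]
  have hp : (0 : ℝ) ≤ (4 : ℝ) ^ α := by positivity
  have h5 : ((4 : ℝ) ^ α * constK α) ^ 2 / 8 ≤ 1 / 2 * constK α ^ 2 := by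
    rw [mul_pow]
    have : ((4 : ℝ) ^ α) ^ 2 ≤ 4 := by nlinarith
    nlinarith [mul_le_mul_of_nonneg_right this (sq_nonneg (constK α))]
  rw [e]
  refine mul_le_mul_of_nonneg_left (Finset.expect_le_expect fun x _ => ?_) zero_le_two
  gcongr

end Cube

theorem corollary4p1 (n : ℕ) (f : Cube n → ℂ) :
    ((𝔼 x : Cube n, Real.exp ‖f x - 𝔼 y : Cube n, f y‖)
        ≤ 2 * (𝔼 x : Cube n, Real.exp (Real.pi ^ 2 / 32 * Cube.gradLength f x ^ 2)) ∧
      2 * (𝔼 x : Cube n, Real.exp (Real.pi ^ 2 / 32 * Cube.gradLength f x ^ 2))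
        ≤ 2 * Real.exp (Real.pi ^ 2 / 32 * (⨆ x : Cube n, Cube.gradLength f x) ^ 2)) ∧
    ∀ α : ℝ, 0 < α → α < 1 / 2 →
      MeasureTheory.IntegrableOn (fun θ : ℝ => (-Real.log (Real.cos θ)) ^ (-α))
        (Set.Icc 0 (Real.pi / 2)) ∧
      (𝔼 x : Cube n, Real.exp ‖Cube.laplacianPow α f x‖)
        ≤ 2 * (𝔼 x : Cube n, Real.exp (1 / 2 * Cube.constK α ^ 2 * Cube.gradLength f x ^ 2)) ∧
      2 * (𝔼 x : Cube n, Real.exp (1 / 2 * Cube.constK α ^ 2 * Cube.gradLength f x ^ 2))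
        ≤ 2 * Real.exp
          (1 / 2 * Cube.constK α ^ 2 * (⨆ x : Cube n, Cube.gradLength f x) ^ 2) := by
  refine ⟨⟨Cube.expect_exp_norm_sub_expect_le f, ?_⟩, fun α h0 h1 =>
    ⟨Cube.integrableOn_neg_log_cos_rpow h0.le h1, Cube.expect_exp_norm_laplacianPow_le f h0 h1, ?_⟩⟩
  · exact mul_le_mul_of_nonneg_left (Cube.expect_exp_gradLength_le f (by positivity)) zero_le_two
  · exact mul_le_mul_of_nonneg_left (Cube.expect_exp_gradLength_le f (by positivity)) zero_le_two
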